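/- For $n\ge 2$ let $[n]=\{1,\dots,n\}$, and call a sequence $(i,j,k,\ell)$ of distinct elements of $[n]$ cyclic if one of its cyclic rotations is strictly increasing. Let $\mathcal A_n$ be the unital associative $\mathbb Q$-algebra generated by elements $x_{ij}$ and $x_{ij}^{-1}$ (mutually inverse), for $i,j\in[n]$, $i\ne j$, subject to the triangle relations $$x_{ij}x_{kj}^{-1}x_{ki}=x_{ik}x_{jk}^{-1}x_{ji}\qquad\text{for all distinct } i,j,k\in[n],$$ and the exchange relations $$x_{j\ell}=x_{jk}x_{ik}^{-1}x_{i\ell}+x_{ji}x_{ki}^{-1}x_{k\ell}\qquad\text{for all cyclic }(i,j,k,\ell)\text{ in }[n].$$ For a unital ring $R$ and a multiplicative submonoid $S\subseteq R$, the universal localization $R[S^{-1}]$ is the quotient of the free product of $R$ and the monoid ring $\mathbb Z S^{op}=\bigoplus_{s\in S}\mathbb Z[s]$ by the ideal generated by all $s*[s]-1$ and $[s]*s-1$ with $s\in S$. Theorem. For each $n\ge 2$ the algebra $\mathcal A_n$ contains a $\mathbb Q$-subalgebra $\mathcal A'_n$ that is isomorphic, as a $\mathbb Q$-algebra, to the group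 algebra $\mathbb Q F_{3n-4}$ of the free group on $3n-4$ generators, such that $\mathcal A_n$ is the universal localization of $\mathcal A'_n$ by some multiplicative submonoid $S$ of $\mathcal A'_n\setminus\{0\}$; that is, there is a ring isomorphism $\mathcal A'_n[S^{-1}]\to\mathcal A_n$ whose composition with the canonical map $\mathcal A'_n\to\mathcal A'_n[S^{-1}]$ is the inclusion $\mathcal A'_n\subseteq\mathcal A_n$. -/

import Mathlib

/-- The sequence `(i, j, k, l)` in `[n]` (identified with `Fin n`) is cyclic: one of its cyclic
rotations is strictly increasing. -/
def IsCyclicQuad {n : ℕ} (i j k l : Fin n) : Prop :=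
  (i < j ∧ j < k ∧ k < l) ∨ (j < k ∧ k < l ∧ l < i) ∨
    (k < l ∧ l < i ∧ i < j) ∨ (l < i ∧ i < j ∧ j < k)

/-- The generators of the algebra of the noncommutative `n`-gon: the symbols `x i j` and
`xinv i j` (standing for `x i j` to the power `-1`), for `i ≠ j`. -/
inductive PolygonGen (n : ℕ) : Type
  | x (i j : Fin n) (h : i ≠ j) : PolygonGen n
  | xinv (i j : Fin n) (h : i ≠ j) : PolygonGen n

namespace PolygonGen

/-- The generator `x i j` in the free algebra. -/
noncomputable def X {n : ℕ} (i j : Fin n) (h : i ≠ j) : FreeAlgebra ℚ (PolygonGen n) :=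
  FreeAlgebra.ι ℚ (PolygonGen.x i j h)

/-- The generator `xinv i j` in the free algebra. -/
noncomputable def Xinv {n : ℕ} (i j : Fin n) (h : i ≠ j) : FreeAlgebra ℚ (PolygonGen n) :=
  FreeAlgebra.ι ℚ (PolygonGen.xinv i j h)

end PolygonGen

open PolygonGen in
/-- The defining relations of the algebra of the noncommutative `n`-gon: `xinv i j` is the
two-sided inverse of `x i j`, the triangle relations for distinct `i, j, k`, and the exchange
relations for cyclic `(i, j, k, l)`. The inequalities listed in `exchange` follow from
`IsCyclicQuad i j k l`. -/
inductive PolygonRel (n : ℕ) : FreeAlgebra ℚ (PolygonGen n) → FreeAlgebra ℚ (PolygonGen n) → Prop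
  | mul_inv (i j : Fin n) (h : i ≠ j) : PolygonRel n (X i j h * Xinv i j h) 1
  | inv_mul (i j : Fin n) (h : i ≠ j) : PolygonRel n (Xinv i j h * X i j h) 1
  | triangle (i j k : Fin n) (hij : i ≠ j) (hik : i ≠ k) (hjk : j ≠ k) :
      PolygonRel n (X i j hij * Xinv k j hjk.symm * X k i hik.symm)
        (X i k hik * Xinv j k hjk * X j i hij.symm)
  | exchange (i j k l : Fin n) (hc : IsCyclicQuad i j k l)
      (hij : i ≠ j) (hik : i ≠ k) (hil : i ≠ l) (hjk : j ≠ k) (hjl : j ≠ l) (hkl : k ≠ l) :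
      PolygonRel n (X j l hjl)
        (X j k hjk * Xinv i k hik * X i l hil + X j i hij.symm * Xinv k i hik.symm * X k l hkl)

/-- The `ℚ`-algebra of the noncommutative `n`-gon. -/
abbrev PolygonAlgebra (n : ℕ) : Type := RingQuot (PolygonRel n)

/-- The inequalities in the exchange relations are automatic. -/
theorem IsCyclicQuad.distinct {n : ℕ} {i j k l : Fin n} (h : IsCyclicQuad i j k l) :
    i ≠ j ∧ i ≠ k ∧ i ≠ l ∧ j ≠ k ∧ j ≠ l ∧ k ≠ l := by
  unfold IsCyclicQuad at h
  omega

section UniversalLocalization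

universe u v

/-- The defining relations of the universal localization of `R` by `S`, on the free ring generated
by symbols `r` (for `r` in `R`) and `[s]` (for `s` in `S`): the first three say that the symbols
`r` generate a homomorphic image of the ring `R`, the next two do the same for the monoid ring
`ℤ Sᵒᵖ` and the symbols `[s]` (so that together these five present the free product of
`R` and `ℤ Sᵒᵖ`), and the last two are the relations `s * [s] = 1` and `[s] * s = 1`. -/
inductive UnivLocRel {R : Type u} [Ring R] (S : Submonoid R) :
    FreeAlgebra ℤ (R ⊕ S) → FreeAlgebra ℤ (R ⊕ S) → Prop
  | add (a b : R) : UnivLocRel S (FreeAlgebra.ι ℤ (Sum.inl (a + b)))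
      (FreeAlgebra.ι ℤ (Sum.inl a) + FreeAlgebra.ι ℤ (Sum.inl b))
  | mul (a b : R) : UnivLocRel S (FreeAlgebra.ι ℤ (Sum.inl (a * b)))
      (FreeAlgebra.ι ℤ (Sum.inl a) * FreeAlgebra.ι ℤ (Sum.inl b))
  | one : UnivLocRel S (FreeAlgebra.ι ℤ (Sum.inl 1)) 1
  | op_mul (s t : S) : UnivLocRel S (FreeAlgebra.ι ℤ (Sum.inr (s * t)))
      (FreeAlgebra.ι ℤ (Sum.inr t) * FreeAlgebra.ι ℤ (Sum.inr s))
  | op_one : UnivLocRel S (FreeAlgebra.ι ℤ (Sum.inr 1)) 1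
  | mul_inv (s : S) :
      UnivLocRel S (FreeAlgebra.ι ℤ (Sum.inl (s : R)) * FreeAlgebra.ι ℤ (Sum.inr s)) 1
  | inv_mul (s : S) :
      UnivLocRel S (FreeAlgebra.ι ℤ (Sum.inr s) * FreeAlgebra.ι ℤ (Sum.inl (s : R))) 1

/-- The universal localization `R[S⁻¹]` of a (not necessarily commutative) ring `R` by a
multiplicative submonoid `S`. -/
abbrev UnivLoc {R : Type u} [Ring R] (S : Submonoid R) : Type u := RingQuot (UnivLocRel S)

namespace UnivLoc

variable {R : Type u} [Ring R] (S : Submonoid R)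

/-- The symbol of `r` in the universal localization. -/
noncomputable def of (r : R) : UnivLoc S :=
  RingQuot.mkRingHom (UnivLocRel S) (FreeAlgebra.ι ℤ (Sum.inl r))

/-- The symbol `[s]` in the universal localization. -/
noncomputable def inv (s : S) : UnivLoc S :=
  RingQuot.mkRingHom (UnivLocRel S) (FreeAlgebra.ι ℤ (Sum.inr s))

/-- The canonical ring homomorphism from `R` to `R[S⁻¹]`. -/
noncomputable def can : R →+* UnivLoc S :=
  RingHom.mk'
    { toFun := of S
      map_one' := by
        simpa [of] using RingQuot.mkRingHom_rel (UnivLocRel.one (S := S))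
      map_mul' := fun a b => by
        simpa [of] using RingQuot.mkRingHom_rel (UnivLocRel.mul (S := S) a b) }
    (fun a b => by
      simpa [of] using RingQuot.mkRingHom_rel (UnivLocRel.add (S := S) a b))

theorem can_mul_inv (s : S) : can S s * inv S s = 1 := by
  change of S s * inv S s = 1
  simpa [of, inv] using RingQuot.mkRingHom_rel (UnivLocRel.mul_inv s)

theorem inv_mul_can (s : S) : inv S s * can S s = 1 := by
  change inv S s * of S s = 1
  simpa [of, inv] using RingQuot.mkRingHom_rel (UnivLocRel.inv_mul s)

theorem isUnit_can (s : S) : IsUnit (can S s) :=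
  ⟨⟨_, _, can_mul_inv S s, inv_mul_can S s⟩, rfl⟩

/-- The universal property of `R[S⁻¹]`: a ring homomorphism out of `R` that makes the elements of
`S` invertible extends uniquely to `R[S⁻¹]`. -/
theorem existsUnique_lift {T : Type v} [Ring T] (g : R →+* T) (hg : ∀ s : S, IsUnit (g s)) :
    ∃! h : UnivLoc S →+* T, h.comp (can S) = g := by
  let φ : FreeAlgebra ℤ (R ⊕ S) →+* T :=
    (FreeAlgebra.lift ℤ (Sum.elim g fun s : S => ((hg s).unit⁻¹ : Tˣ).val)).toRingHom
  have hl : ∀ r : R, φ (FreeAlgebra.ι ℤ (Sum.inl r)) = g r := fun r => by simp [φ]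
  have hr : ∀ s : S, φ (FreeAlgebra.ι ℤ (Sum.inr s)) = ((hg s).unit⁻¹ : Tˣ).val := fun s => by
    simp [φ]
  have hφ : ∀ ⦃a b⦄, UnivLocRel S a b → φ a = φ b := by
    intro a b hab
    cases hab with
    | add a b => simp only [map_add, hl]
    | mul a b => simp only [map_mul, hl]
    | one => simp only [map_one, hl]
    | op_mul s t =>
      simp only [map_mul, hr]
      rw [← Units.val_mul, ← mul_inv_rev]
      congr 2
      ext
      simp
    | op_one =>
      simp only [map_one, hr]
      have : (hg 1).unit = 1 := by ext; simp
      rw [this]; simp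
    | mul_inv s => simp only [map_mul, map_one, hl, hr]; exact (hg s).mul_val_inv
    | inv_mul s => simp only [map_mul, map_one, hl, hr]; exact (hg s).val_inv_mul
  have hcan : ∀ h : UnivLoc S →+* T, h.comp (can S) = g → ∀ r, h (of S r) = g r :=
    fun h hh r => DFunLike.congr_fun hh r
  refine ⟨RingQuot.lift ⟨φ, hφ⟩, ?_, ?_⟩
  · ext r
    change RingQuot.lift ⟨φ, hφ⟩ (RingQuot.mkRingHom _ _) = _
    rw [RingQuot.lift_mkRingHom_apply, hl]
  · intro h hh
    apply RingQuot.ringQuot_ext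
    have key : (h.comp (RingQuot.mkRingHom (UnivLocRel S))).toIntAlgHom = φ.toIntAlgHom := by
      apply FreeAlgebra.hom_ext
      funext x
      rcases x with r | s
      · exact (hcan h hh r).trans (hl r).symm
      · refine Eq.trans ?_ (hr s).symm
        change h (inv S s) = _
        have h1 : h (inv S s) * g s = 1 := by
          rw [← hcan h hh s, ← map_mul]
          exact (congrArg h (inv_mul_can S s)).trans (map_one h)
        exact Units.eq_inv_of_mul_eq_one_right (u := (hg s).unit) h1
    ext x
    have := DFunLike.congr_fun key x
    simpa [RingQuot.lift_mkRingHom_apply] using this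

end UnivLoc

/-- A ring homomorphism `f : R → R'` exhibits `R'` as the universal localization of `R` by `S`:
there is a ring isomorphism from `R[S⁻¹]` onto `R'` compatible with the maps from `R`. -/
def IsUnivLoc {R : Type u} {R' : Type v} [Ring R] [Ring R'] (S : Submonoid R) (f : R →+* R') :
    Prop :=
  ∃ e : UnivLoc S ≃+* R', ∀ r : R, e (UnivLoc.can S r) = f r

end UniversalLocalization

/-! Write `n = m + 2` and triangulate the polygon by the diagonals at the vertex `0`. Divide every
other edge by the edges joining its ends to `0`. The triangle relations through `0` say that the
quotients `nedge i j` are symmetric, and the exchange relations through `0` say that they add up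
along `i < j < k`. They are thus differences of points, and for such differences all the other
relations are formal identities (`IsDifference`). Hence a homomorphism out of the algebra is a free
choice of `2 * (m + 1)` units at `0` and of points, up to translation, with invertible differences
(`exists_algHom_of_fan`). In other words, the algebra is the group algebra of a free group on `3 * m
+ 2` generators with the sums of consecutive `y k` inverted.

This group algebra embeds because twisting `y k` by `t ^ k` makes those sums invertible Laurent
series: the lowest term is a unit. The twist is injective and factors through the polygon algebra
(`fanHom_injective`). The localization statement compares two universal properties
(`isUnivLoc_fanSubmonoid`). -/

namespace PolygonAlgebra

open PolygonGen

/-! ### Edges as units and the universal property -/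

section Generators

variable {n : ℕ}

theorem mkAlgHom_X_mul_Xinv {i j : Fin n} (h : i ≠ j) :
    RingQuot.mkAlgHom ℚ (PolygonRel n) (X i j h) * RingQuot.mkAlgHom ℚ (PolygonRel n) (Xinv i j h) =
      1 := by
  simpa using RingQuot.mkAlgHom_rel ℚ (PolygonRel.mul_inv i j h)

theorem mkAlgHom_Xinv_mul_X {i j : Fin n} (h : i ≠ j) :
    RingQuot.mkAlgHom ℚ (PolygonRel n) (Xinv i j h) * RingQuot.mkAlgHom ℚ (PolygonRel n) (X i j h) =
      1 := by
  simpa using RingQuot.mkAlgHom_rel ℚ (PolygonRel.inv_mul i j h)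

/-- The generator `x i j` as a unit of the polygon algebra, with the convention `x i i = 1`. -/
noncomputable def edge (i j : Fin n) : (PolygonAlgebra n)ˣ :=
  if h : i ≠ j then ⟨_, _, mkAlgHom_X_mul_Xinv h, mkAlgHom_Xinv_mul_X h⟩ else 1

theorem edge_val {i j : Fin n} (h : i ≠ j) :
    (edge i j : PolygonAlgebra n) = RingQuot.mkAlgHom ℚ (PolygonRel n) (X i j h) := by
  simp [edge, h]

theorem edge_inv_val {i j : Fin n} (h : i ≠ j) :
    ((edge i j)⁻¹.val : PolygonAlgebra n) =
      RingQuot.mkAlgHom ℚ (PolygonRel n) (Xinv i j h) := by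
  simp [edge, h]

theorem edge_triangle {i j k : Fin n} (hij : i ≠ j) (hik : i ≠ k) (hjk : j ≠ k) :
    edge i j * (edge k j)⁻¹ * edge k i = edge i k * (edge j k)⁻¹ * edge j i := by
  ext
  have := RingQuot.mkAlgHom_rel ℚ (PolygonRel.triangle i j k hij hik hjk)
  simpa only [map_mul, ← edge_val, ← edge_inv_val, Units.val_mul] using this

theorem edge_exchange {i j k l : Fin n} (hc : IsCyclicQuad i j k l) :
    (edge j l : PolygonAlgebra n) = edge j k * (edge i k)⁻¹.val * edge i l +
      edge j i * (edge k i)⁻¹.val * edge k l := by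
  obtain ⟨hij, hik, hil, hjk, hjl, hkl⟩ := hc.distinct
  have := RingQuot.mkAlgHom_rel ℚ (PolygonRel.exchange i j k l hc hij hik hil hjk hjl hkl)
  simpa only [map_mul, map_add, ← edge_val, ← edge_inv_val] using this

theorem algHom_ext_edge {T : Type*} [Ring T] [Algebra ℚ T] {f g : PolygonAlgebra n →ₐ[ℚ] T}
    (h : ∀ i j, i ≠ j → f (edge i j).val = g (edge i j).val) : f = g := by
  apply RingQuot.ringQuot_ext'
  apply FreeAlgebra.hom_ext
  funext a
  cases a with
  | x i j hij =>
    have := h i j hij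
    rwa [edge_val hij] at this
  | xinv i j hij =>
    have h1 : Units.map (f : PolygonAlgebra n →* T) (edge i j) =
        Units.map (g : PolygonAlgebra n →* T) (edge i j) := Units.ext (h i j hij)
    have h2 := congrArg (fun u : Tˣ => (u⁻¹).val) h1
    simp only [← map_inv] at h2
    change f (edge i j)⁻¹.val = g (edge i j)⁻¹.val at h2
    rwa [edge_inv_val hij] at h2

/-- Units satisfying the triangle and exchange relations define a homomorphism out of the polygon
algebra. -/
theorem exists_algHom_of_relations {T : Type*} [Ring T] [Algebra ℚ T] (w : Fin n → Fin n → Tˣ)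
    (triangle : ∀ i j k, i ≠ j → i ≠ k → j ≠ k →
      w i j * (w k j)⁻¹ * w k i = w i k * (w j k)⁻¹ * w j i)
    (exchange : ∀ i j k l, IsCyclicQuad i j k l →
      (w j l : T) = w j k * (w i k)⁻¹.val * w i l + w j i * (w k i)⁻¹.val * w k l) :
    ∃ g : PolygonAlgebra n →ₐ[ℚ] T, ∀ i j, i ≠ j → g (edge i j).val = w i j := by
  let φ : FreeAlgebra ℚ (PolygonGen n) →ₐ[ℚ] T := FreeAlgebra.lift ℚ fun a =>
    match a with
    | .x i j _ => (w i j : T)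
    | .xinv i j _ => (w i j)⁻¹.val
  have hx : ∀ i j h, φ (X i j h) = w i j := fun i j h => by simp [φ, X]
  have hxinv : ∀ i j h, φ (Xinv i j h) = (w i j)⁻¹.val := fun i j h => by simp [φ, Xinv]
  have hφ : ∀ ⦃a b⦄, PolygonRel n a b → φ a = φ b := by
    intro a b hab
    cases hab with
    | mul_inv i j h => simp [hx, hxinv]
    | inv_mul i j h => simp [hx, hxinv]
    | triangle i j k hij hik hjk =>
      simpa only [map_mul, hx, hxinv, Units.val_mul] using
        congrArg Units.val (triangle i j k hij hik hjk)
    | exchange i j k l hc =>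
      simpa only [map_mul, map_add, hx, hxinv] using exchange i j k l hc
  refine ⟨RingQuot.liftAlgHom ℚ ⟨φ, hφ⟩, fun i j h => ?_⟩
  rw [edge_val h, RingQuot.liftAlgHom_mkAlgHom_apply, hx]

end Generators

/-! ### Differences of points satisfy the relations -/

section Difference

variable {T : Type*} [Ring T]

/-- Eliminating one letter through the additive relation turns both sides into the same palindrome;
for `b = a + c`, both are `a - a * b⁻¹ * a`. -/
theorem mul_inv_mul_comm_of_eq_add {a b c : Tˣ}
    (h : (b : T) = a + c ∨ (c : T) = a + b ∨ (a : T) = b + c) :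
    a * b⁻¹ * c = c * b⁻¹ * a := by
  ext
  simp only [Units.val_mul]
  rcases h with h | h | h
  · have hc : (c : T) = b - a := by rw [h]; abel
    rw [hc]
    simp [mul_sub, sub_mul, mul_assoc]
  · rw [h]
    simp [mul_add, add_mul, mul_assoc]
  · rw [h]
    simp [mul_add, add_mul, mul_assoc]

theorem eq_mul_inv_mul_add_mul_inv_mul {u : Tˣ} {a b c s t : T} (hu : (u : T) = a + b)
    (ht : t = u + c) (hs : s = b + c) : s = b * u⁻¹.val * t + a * u⁻¹.val * c := by
  have ha : a = u - b := by rw [hu]; abel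
  rw [hs, ht, ha]
  simp only [mul_add, sub_mul, mul_assoc, Units.inv_mul, Units.mul_inv_cancel_left, mul_one]
  abel

theorem eq_mul_inv_mul_add_mul_inv_mul' {u : Tˣ} {a b c s t : T} (hu : (u : T) = b + c)
    (ht : t = a + u) (hs : s = a + b) : s = a * u⁻¹.val * c + t * u⁻¹.val * b := by
  have hc : c = u - b := by rw [hu]; abel
  rw [hs, ht, hc]
  simp only [mul_sub, add_mul, mul_assoc, Units.inv_mul, Units.mul_inv_cancel_left, mul_one]
  abel

/-- A family of units `Y i j`, symmetric in `i` and `j`, that are the differences of the points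
`p i` of a ring up to sign. -/
structure IsDifference {k : ℕ} (p : Fin k → T) (Y : Fin k → Fin k → Tˣ) : Prop where
  symm (i j : Fin k) : i ≠ j → Y i j = Y j i
  eq_sub (i j : Fin k) : i < j → (Y i j : T) = p j - p i

namespace IsDifference

variable {k : ℕ} {p : Fin k → T} {Y : Fin k → Fin k → Tˣ}

theorem add_eq (hY : IsDifference p Y) {i j l : Fin k} (hij : i < j) (hjl : j < l) :
    (Y i l : T) = Y i j + Y j l := by
  rw [hY.eq_sub i l (hij.trans hjl), hY.eq_sub i j hij, hY.eq_sub j l hjl]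
  abel

theorem triangle (hY : IsDifference p Y) {i j l : Fin k} (hij : i ≠ j) (hil : i ≠ l)
    (hjl : j ≠ l) :
    Y i j * (Y l j)⁻¹ * Y l i = Y i l * (Y j l)⁻¹ * Y j i := by
  rw [hY.symm j l hjl, hY.symm i l hil, hY.symm j i hij.symm]
  apply mul_inv_mul_comm_of_eq_add
  have := hY.symm i j hij
  have := hY.symm i l hil
  have := hY.symm j l hjl
  have hadd := fun {a b c : Fin k} => hY.add_eq (i := a) (j := b) (l := c)
  rcases lt_trichotomy i j with h1 | h1 | h1 <;> rcases lt_trichotomy j l with h2 | h2 | h2 <;>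
    rcases lt_trichotomy i l with h3 | h3 | h3 <;> grind

theorem exchange (hY : IsDifference p Y) {i j l m : Fin k} (hc : IsCyclicQuad i j l m) :
    (Y j m : T) = Y j l * (Y i l)⁻¹.val * Y i m + Y j i * (Y l i)⁻¹.val * Y l m := by
  obtain ⟨hij, hil, him, hjl, hjm, hlm⟩ := hc.distinct
  rw [hY.symm l i hil.symm]
  -- The inverted difference `Y i l` is split by `j` in the first and last rotations, and by `m` in
  -- the other two.
  rcases hc with ⟨h1, h2, h3⟩ | ⟨h1, h2, h3⟩ | ⟨h1, h2, h3⟩ | ⟨h1, h2, h3⟩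
  · rw [hY.symm j i hij.symm]
    exact eq_mul_inv_mul_add_mul_inv_mul (hY.add_eq h1 h2) (hY.add_eq (h1.trans h2) h3)
      (hY.add_eq h2 h3)
  · rw [hY.symm i l hil, hY.symm i m him]
    exact eq_mul_inv_mul_add_mul_inv_mul' (hY.add_eq h2 h3)
      (by rw [hY.add_eq h1 (h2.trans h3), hY.add_eq h2 h3]) (hY.add_eq h1 h2)
  · rw [hY.symm j i hij.symm, hY.symm i l hil, hY.symm i m him, hY.symm j m hjm, hY.symm j l hjl,
      add_comm]
    exact eq_mul_inv_mul_add_mul_inv_mul' (by rw [hY.add_eq h1 h2, add_comm])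
      (by rw [hY.add_eq (h1.trans h2) h3, add_comm]) (by rw [hY.add_eq h2 h3, add_comm])
  · rw [hY.symm j i hij.symm, hY.symm i m him, hY.symm l m hlm, hY.symm j m hjm, add_comm]
    exact eq_mul_inv_mul_add_mul_inv_mul (by rw [hY.add_eq h2 h3, add_comm])
      (by rw [hY.add_eq h1 (h2.trans h3), add_comm]) (by rw [hY.add_eq h1 h2, add_comm])

end IsDifference

end Difference

end PolygonAlgebra

/-! ### The fan at the vertex `0` -/

namespace PolygonAlgebra

variable {m : ℕ}

theorem isCyclicQuad_succ {k : ℕ} {i j l r : Fin k} :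
    IsCyclicQuad i.succ j.succ l.succ r.succ ↔ IsCyclicQuad i j l r := by
  simp [IsCyclicQuad]

section Fan

variable {T : Type*} [Ring T] {p : Fin (m + 1) → T} {Y : Fin (m + 1) → Fin (m + 1) → Tˣ}

/-- The edges of the polygon on the vertices `0, ..., m + 1` whose edges at `0` are
`x (j + 1) 0 = u j` and `x 0 (j + 1) = v j` and whose other edges are
`x (i + 1) (j + 1) = u i * Y i j * v j`. -/
def fanEdge (u v : Fin (m + 1) → Tˣ) (Y : Fin (m + 1) → Fin (m + 1) → Tˣ) (i j : Fin (m + 2)) :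
    Tˣ :=
  Fin.cases (motive := fun _ => Tˣ) (Fin.cases (motive := fun _ => Tˣ) 1 v j)
    (fun a => Fin.cases (motive := fun _ => Tˣ) (u a) (fun b => u a * Y a b * v b) j) i

variable (u v : Fin (m + 1) → Tˣ)

@[simp]
theorem fanEdge_zero_succ (b : Fin (m + 1)) : fanEdge u v Y 0 b.succ = v b := rfl

@[simp]
theorem fanEdge_succ_zero (a : Fin (m + 1)) : fanEdge u v Y a.succ 0 = u a := rfl

@[simp]
theorem fanEdge_succ_succ (a b : Fin (m + 1)) :
    fanEdge u v Y a.succ b.succ = u a * Y a b * v b := rfl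

/-- If `0` is a vertex, the units cancel and the symmetry of `Y` remains; otherwise the outer
factors `u i` and `v i` frame the relation for `Y`. -/
theorem fanEdge_triangle (hY : IsDifference p Y) {i j k : Fin (m + 2)} (hij : i ≠ j) (hik : i ≠ k)
    (hjk : j ≠ k) :
    fanEdge u v Y i j * (fanEdge u v Y k j)⁻¹ * fanEdge u v Y k i =
      fanEdge u v Y i k * (fanEdge u v Y j k)⁻¹ * fanEdge u v Y j i := by
  cases i using Fin.cases <;> cases j using Fin.cases <;> cases k using Fin.cases <;>
    first
    | exact absurd rfl ‹_›
    | skip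
  all_goals
    simp only [ne_eq, Fin.succ_inj] at hij hik hjk
    simp only [fanEdge_zero_succ, fanEdge_succ_zero, fanEdge_succ_succ]
  · rw [hY.symm _ _ hjk]
    group
  · rw [hY.symm _ _ hik]
    group
  · rw [hY.symm _ _ hij]
    group
  · rename_i i j k
    calc
      _ = u i * (Y i j * (Y k j)⁻¹ * Y k i) * v i := by group
      _ = _ := by rw [hY.triangle hij hik hjk]; group

/-- A quadrilateral through `0` reduces to the additivity of `Y`, with one case for each position of
`0`; any other reduces to the exchange relation for `Y`. -/
theorem fanEdge_exchange (hY : IsDifference p Y) {i j k l : Fin (m + 2)}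
    (hc : IsCyclicQuad i j k l) :
    (fanEdge u v Y j l : T) = fanEdge u v Y j k * (fanEdge u v Y i k)⁻¹.val * fanEdge u v Y i l +
      fanEdge u v Y j i * (fanEdge u v Y k i)⁻¹.val * fanEdge u v Y k l := by
  obtain ⟨hij, hik, hil, hjk, hjl, hkl⟩ := hc.distinct
  cases i using Fin.cases <;> cases j using Fin.cases <;> cases k using Fin.cases <;>
    cases l using Fin.cases <;>
    first
    | exact absurd rfl ‹_›
    | skip
  all_goals
    simp only [ne_eq, Fin.succ_inj] at hij hik hil hjk hjl hkl
    simp only [fanEdge_zero_succ, fanEdge_succ_zero, fanEdge_succ_succ]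
  all_goals
    simp only [Units.val_mul, mul_inv_rev, mul_assoc, Units.mul_inv_cancel_left,
      Units.inv_mul_cancel_left]
  · rename_i a b c
    have h : a < b ∧ b < c := by simpa [IsCyclicQuad] using hc
    rw [hY.add_eq h.1 h.2, add_mul, mul_add]
  · rename_i a b c
    have h : b < c ∧ c < a := by simpa [IsCyclicQuad] using hc
    rw [hY.symm a b hik, hY.symm a c hil, ← mul_add, ← add_mul, add_comm (Y c a : T),
      ← hY.add_eq h.1 h.2, Units.inv_mul_cancel_left]
  · rename_i a b c
    have h : c < a ∧ a < b := by simpa [IsCyclicQuad] using hc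
    rw [hY.symm b c hjl, hY.symm a c hil, hY.symm b a (Ne.symm hij), hY.add_eq h.1 h.2, add_mul,
      mul_add]
  · rename_i a b c
    have h : a < b ∧ b < c := by simpa [IsCyclicQuad] using hc
    rw [hY.symm c a (Ne.symm hik), hY.symm b a (Ne.symm hij), Units.inv_mul, Units.inv_mul,
      ← mul_add, mul_one, ← add_mul, add_comm (Y b c : T), ← hY.add_eq h.1 h.2, Units.mul_inv,
      mul_one]
  · rename_i a b c d
    have h := hY.exchange (isCyclicQuad_succ.mp hc)
    rw [h]
    simp only [mul_add, add_mul, mul_assoc]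

end Fan

/-! ### Normalized edges -/

section NormalizedEdge

/-- The edge `x (i + 1) (j + 1)`, normalized by the edges to the vertex `0`. -/
noncomputable def nedge (i j : Fin (m + 1)) : (PolygonAlgebra (m + 2))ˣ :=
  (edge i.succ 0)⁻¹ * edge i.succ j.succ * (edge 0 j.succ)⁻¹

theorem edge_succ_succ (i j : Fin (m + 1)) :
    edge i.succ j.succ = edge i.succ 0 * nedge i j * edge 0 j.succ := by
  simp [nedge, mul_assoc]

theorem nedge_symm {i j : Fin (m + 1)} (h : i ≠ j) : nedge i j = nedge j i := by
  have := edge_triangle (Fin.succ_ne_zero i).symm (Fin.succ_ne_zero j).symm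
    ((Fin.succ_injective _).ne h)
  rw [edge_succ_succ, edge_succ_succ] at this
  simpa [mul_assoc] using this.symm

theorem nedge_add {i j k : Fin (m + 1)} (hij : i < j) (hjk : j < k) :
    (nedge i k : PolygonAlgebra (m + 2)) = nedge i j + nedge j k := by
  have hc : IsCyclicQuad 0 i.succ j.succ k.succ := by
    simp [IsCyclicQuad, hij, hjk]
  have := edge_exchange hc
  rw [edge_succ_succ i k, edge_succ_succ i j, edge_succ_succ j k] at this
  simp only [Units.val_mul, mul_assoc, Units.mul_inv_cancel_left, Units.inv_mul_cancel_left] at this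
  rw [← mul_add, (edge i.succ 0).isUnit.mul_right_inj, ← add_mul,
    (edge 0 k.succ).isUnit.mul_left_inj] at this
  exact this

theorem map_partialSum_sub {R : Type*} [Ring R] (f : R →+* PolygonAlgebra (m + 2)) {y : Fin m → R}
    (hy : ∀ k, f (y k) = nedge k.castSucc k.succ) {i j : Fin (m + 1)} (h : i < j) :
    f (Fin.partialSum y j - Fin.partialSum y i) = nedge i j := by
  induction j using Fin.induction with
  | zero => exact absurd h (Fin.not_lt_zero i)
  | succ j ih =>
    rw [Fin.partialSum_succ]
    rcases (Fin.le_castSucc_iff.mpr h).lt_or_eq with h' | rfl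
    · rw [add_sub_right_comm, map_add, ih h', nedge_add h' Fin.castSucc_lt_succ, hy]
    · simp [hy]

/-- Every normalized edge is a sum of consecutive ones up to symmetry, every edge is a product of
fan units and a normalized edge, and homomorphisms preserve inverses. -/
theorem algHom_ext_fan {T : Type*} [Ring T] [Algebra ℚ T] {f g : PolygonAlgebra (m + 2) →ₐ[ℚ] T}
    (hv : ∀ j : Fin (m + 1), f (edge 0 j.succ).val = g (edge 0 j.succ).val)
    (hu : ∀ j : Fin (m + 1), f (edge j.succ 0).val = g (edge j.succ 0).val)
    (hy : ∀ k : Fin m, f (nedge k.castSucc k.succ).val = g (nedge k.castSucc k.succ).val) :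
    f = g := by
  have hlt : ∀ i j : Fin (m + 1), i < j → f (nedge i j).val = g (nedge i j).val := by
    intro i j h
    induction j using Fin.induction with
    | zero => exact absurd h (Fin.not_lt_zero i)
    | succ j ih =>
      rcases (Fin.le_castSucc_iff.mpr h).lt_or_eq with h' | rfl
      · rw [nedge_add h' Fin.castSucc_lt_succ, map_add, map_add, ih h', hy]
      · exact hy j
  have hne : ∀ i j : Fin (m + 1), i ≠ j → f (nedge i j).val = g (nedge i j).val := by
    intro i j h
    rcases lt_or_gt_of_ne h with h' | h'
    · exact hlt i j h'
    · rw [nedge_symm h]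
      exact hlt j i h'
  apply algHom_ext_edge
  intro i j hij
  cases i using Fin.cases <;> cases j using Fin.cases
  · exact absurd rfl hij
  · exact hv _
  · exact hu _
  · rename_i i j
    rw [edge_succ_succ]
    simp only [Units.val_mul, map_mul, hv, hu, hne i j (by simpa using hij)]

end NormalizedEdge

/-- The polygon algebra maps to every algebra with units `u j`, `v j` and points `p j` with
invertible differences. -/
theorem exists_algHom_of_fan {T : Type*} [Ring T] [Algebra ℚ T] (u v : Fin (m + 1) → Tˣ)
    (p : Fin (m + 1) → T) (hp : ∀ i j, i < j → IsUnit (p j - p i)) :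
    ∃ g : PolygonAlgebra (m + 2) →ₐ[ℚ] T, (∀ j, g (edge 0 j.succ).val = v j) ∧
      (∀ j, g (edge j.succ 0).val = u j) ∧
      ∀ i j : Fin (m + 1), i < j → g (nedge i j).val = p j - p i := by
  choose! U hU using hp
  -- The diagonal values are arbitrary; `IsDifference` ignores them.
  let Y : Fin (m + 1) → Fin (m + 1) → Tˣ := fun i j => if i < j then U i j else U j i
  have hY : IsDifference p Y := by
    refine ⟨fun i j h => ?_, fun i j h => ?_⟩
    · rcases lt_or_gt_of_ne h with h | h <;> simp [Y, h, h.not_gt]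
    · simp [Y, h, hU i j h]
  obtain ⟨g, hg⟩ := exists_algHom_of_relations (fanEdge u v Y)
    (fun i j k => fanEdge_triangle u v hY) (fun i j k l => fanEdge_exchange u v hY)
  have hv : ∀ j : Fin (m + 1), g (edge 0 j.succ).val = v j := fun j => by
    simp [hg 0 j.succ (Fin.succ_ne_zero j).symm]
  have hu : ∀ j : Fin (m + 1), g (edge j.succ 0).val = u j := fun j => by
    simp [hg j.succ 0 (Fin.succ_ne_zero j)]
  refine ⟨g, hv, hu, fun i j h => ?_⟩
  have := hg i.succ j.succ (by simpa using h.ne)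
  rw [edge_succ_succ, fanEdge_succ_succ] at this
  simp only [Units.val_mul, map_mul, hv, hu] at this
  rw [(v j).isUnit.mul_left_inj, (u i).isUnit.mul_right_inj] at this
  rw [this, hY.eq_sub i j h]

end PolygonAlgebra

/-! ### Laurent series over a group algebra -/

section LaurentTwist

variable {Γ : Type*} [Group Γ]

/-- The homomorphism from a `ℤ`-graded group to the Laurent series over its group algebra, which
twists a group element by its degree. -/
noncomputable def laurentTwist (d : Γ →* Multiplicative ℤ) :
    Γ →* HahnSeries ℤ (MonoidAlgebra ℚ Γ) where
  toFun g := HahnSeries.single (d g).toAdd (MonoidAlgebra.of ℚ Γ g)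
  map_one' := by simp [← MonoidAlgebra.one_def]
  map_mul' g h := by simp [HahnSeries.single_mul_single]

/-- The coefficient of `g` can be read off from the twisted series in degree `d g`. -/
theorem lift_laurentTwist_injective (d : Γ →* Multiplicative ℤ) :
    Function.Injective (MonoidAlgebra.lift ℚ (HahnSeries ℤ (MonoidAlgebra ℚ Γ)) Γ
      (laurentTwist d)) := by
  have key : ∀ (a : MonoidAlgebra ℚ Γ) (g : Γ),
      ((MonoidAlgebra.lift ℚ (HahnSeries ℤ (MonoidAlgebra ℚ Γ)) Γ (laurentTwist d) a).coeff
        (d g).toAdd).coeff g = a.coeff g := by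
    intro a g
    induction a using MonoidAlgebra.induction_on with
    | of h =>
      rw [MonoidAlgebra.lift_of]
      by_cases hgh : h = g
      · subst hgh
        simp [laurentTwist]
      · by_cases hd : (d g).toAdd = (d h).toAdd <;>
          simp [laurentTwist, hgh, hd]
    | add x y hx hy => simp [hx, hy]
    | smul r x hx => simp [hx]
  intro a b h
  ext g
  rw [← key a, ← key b, h]

end LaurentTwist

theorem HahnSeries.isUnit_ofPowerSeries {R : Type*} [Ring R] {q : PowerSeries R}
    (h : PowerSeries.constantCoeff q = 1) : IsUnit (HahnSeries.ofPowerSeries ℤ R q) :=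
  IsUnit.map _ ⟨⟨q, _, PowerSeries.mul_invOfUnit q 1 h, PowerSeries.invOfUnit_mul q 1 h⟩, rfl⟩

/-- Factoring out the lowest term `a i * t ^ i` leaves a power series with constant coefficient `1`.
-/
theorem HahnSeries.isUnit_partialSum_sub {R : Type*} [Ring R] {m : ℕ} (a : Fin m → Rˣ)
    {i j : Fin (m + 1)} (h : i < j) :
    IsUnit (Fin.partialSum (fun k => HahnSeries.single (k : ℤ) (a k : R)) j -
      Fin.partialSum (fun k => HahnSeries.single (k : ℤ) (a k : R)) i) := by
  obtain ⟨i, rfl⟩ := Fin.exists_castSucc_eq.mpr (Fin.ne_last_of_lt h)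
  have hi : IsUnit (HahnSeries.single (i : ℤ) (a i : R)) :=
    ⟨⟨_, HahnSeries.single (-(i : ℤ)) (a i)⁻¹.val, by simp [HahnSeries.single_mul_single],
      by simp [HahnSeries.single_mul_single]⟩, rfl⟩
  suffices ∃ q : PowerSeries R, PowerSeries.constantCoeff q = 1 ∧
      Fin.partialSum (fun k => HahnSeries.single (k : ℤ) (a k : R)) j -
        Fin.partialSum (fun k => HahnSeries.single (k : ℤ) (a k : R)) i.castSucc =
      HahnSeries.single (i : ℤ) (a i : R) * HahnSeries.ofPowerSeries ℤ R q by
    obtain ⟨q, hq, h⟩ := this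
    rw [h]
    exact hi.mul (isUnit_ofPowerSeries hq)
  induction j using Fin.induction with
  | zero => exact absurd h (Fin.not_lt_zero _)
  | succ j ih =>
    rcases (Fin.le_castSucc_iff.mpr h).lt_or_eq with h' | h'
    · obtain ⟨q, hq, e⟩ := ih h'
      have hij : i < j := h'
      have hne : (j - i : ℕ) ≠ 0 := Nat.sub_ne_zero_of_lt hij
      -- The new term is `a j * t ^ j = (a i * t ^ i) * (t ^ (j - i) * (a i)⁻¹ * a j)`; as `j - i >
      -- 0`, the constant coefficient is unchanged.
      refine ⟨q + PowerSeries.X ^ (j - i : ℕ) * PowerSeries.C ((a i)⁻¹.val * a j), ?_, ?_⟩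
      · simp [hq, hne]
      · rw [Fin.partialSum_succ, add_sub_right_comm, e, map_add, mul_add, add_right_inj, map_mul,
          HahnSeries.ofPowerSeries_X_pow, HahnSeries.ofPowerSeries_C, HahnSeries.C_apply,
          HahnSeries.single_mul_single, HahnSeries.single_mul_single, Nat.cast_sub hij.le]
        simp
    · obtain rfl := Fin.castSucc_injective _ h'
      exact ⟨1, by simp, by simp [Fin.partialSum_succ]⟩

/-- Integers are central, hence so are their quotients. This makes `UnivLoc`, which is presented
over `ℤ`, a `ℚ`-algebra. -/
theorem commute_map_rat {T : Type*} [Ring T] (f : ℚ →+* T) (q : ℚ) (x : T) : Commute (f q) x := by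
  have hden : (q.den : ℚ) ≠ 0 := by simp
  let d : Tˣ := Units.map (f : ℚ →* T) (Units.mk0 _ hden)
  have hd : (d : T) = (q.den : T) := by simp [d]
  have hq : f q = (q.num : T) * d⁻¹.val := by
    rw [Units.eq_mul_inv_iff_mul_eq, hd, ← map_natCast f, ← map_mul, Rat.mul_den_eq_num,
      map_intCast]
  rw [hq]
  refine (Int.cast_commute _ _).mul_left (Commute.units_inv_left ?_)
  rw [hd]
  exact Nat.cast_commute _ _

/-! ### The fan group algebra and its localization -/

namespace PolygonAlgebra

variable {m : ℕ}

/-- Index set of the free generators attached to the fan triangulation of the `(m + 2)`-gon at the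
vertex `0`. -/
abbrev FanIndex (m : ℕ) : Type := Fin (m + 1) ⊕ Fin (m + 1) ⊕ Fin m

/-- The free generators attached to the fan triangulation. -/
noncomputable def fanGen : FanIndex m → (PolygonAlgebra (m + 2))ˣ :=
  Sum.elim (fun j => edge 0 j.succ)
    (Sum.elim (fun j => edge j.succ 0) fun k => nedge k.castSucc k.succ)

/-- The homomorphism from the group algebra of the free group on the fan generators. -/
noncomputable def fanHom (m : ℕ) :
    MonoidAlgebra ℚ (FreeGroup (FanIndex m)) →ₐ[ℚ] PolygonAlgebra (m + 2) :=
  MonoidAlgebra.lift ℚ _ _ ((Units.coeHom _).comp (FreeGroup.lift fanGen))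

theorem fanHom_of (a : FanIndex m) :
    fanHom m (MonoidAlgebra.of ℚ _ (FreeGroup.of a)) = fanGen a := by
  rw [fanHom, MonoidAlgebra.lift_of]
  simp

theorem fanGroupAlgebra_hom_ext {T : Type*} [Ring T] [Algebra ℚ T]
    {f g : MonoidAlgebra ℚ (FreeGroup (FanIndex m)) →ₐ[ℚ] T}
    (h : ∀ a, f (MonoidAlgebra.of ℚ _ (FreeGroup.of a)) =
      g (MonoidAlgebra.of ℚ _ (FreeGroup.of a))) : f = g := by
  apply (MonoidAlgebra.lift ℚ T _).symm.injective
  exact FreeGroup.ext_hom _ _ h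

/-- The degrees of the fan generators in which the edges have increasing degrees. -/
def fanDegree : FanIndex m → ℤ := Sum.elim 0 (Sum.elim 0 fun k => (k : ℤ))

/-- A homomorphism out of the group algebra of the fan extends along `fanHom` if it makes the
differences of the partial sums of the normalized edges invertible. -/
theorem exists_comp_fanHom_eq {T : Type*} [Ring T] [Algebra ℚ T]
    (f : MonoidAlgebra ℚ (FreeGroup (FanIndex m)) →ₐ[ℚ] T) (p : Fin (m + 1) → T)
    (hp : ∀ i j, i < j → IsUnit (p j - p i))
    (hpf : ∀ k : Fin m, p k.succ - p k.castSucc =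
      f (MonoidAlgebra.of ℚ _ (FreeGroup.of (Sum.inr (Sum.inr k))))) :
    ∃ g : PolygonAlgebra (m + 2) →ₐ[ℚ] T, g.comp (fanHom m) = f := by
  let γ : FreeGroup (FanIndex m) →* Tˣ :=
    ((f : _ →* T).comp (MonoidAlgebra.of ℚ (FreeGroup (FanIndex m)))).toHomUnits
  obtain ⟨g, hv, hu, hy⟩ := exists_algHom_of_fan
    (fun j => γ (FreeGroup.of (Sum.inr (Sum.inl j)))) (fun j => γ (FreeGroup.of (Sum.inl j))) p hp
  refine ⟨g, fanGroupAlgebra_hom_ext fun a => ?_⟩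
  rw [AlgHom.comp_apply, fanHom_of]
  rcases a with j | j | k
  · exact hv j
  · exact hu j
  · exact (hy _ _ Fin.castSucc_lt_succ).trans (hpf k)

theorem fanHom_injective (m : ℕ) : Function.Injective (fanHom m) := by
  let d : FreeGroup (FanIndex m) →* Multiplicative ℤ :=
    FreeGroup.lift fun a => Multiplicative.ofAdd (fanDegree a)
  let a : Fin m → (MonoidAlgebra ℚ (FreeGroup (FanIndex m)))ˣ := fun k =>
    (MonoidAlgebra.of ℚ (FreeGroup (FanIndex m))).toHomUnits (FreeGroup.of (Sum.inr (Sum.inr k)))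
  obtain ⟨g, hg⟩ := exists_comp_fanHom_eq (MonoidAlgebra.lift ℚ _ _ (laurentTwist d))
    (Fin.partialSum fun k => HahnSeries.single (k : ℤ) (a k).val)
    (fun i j h => HahnSeries.isUnit_partialSum_sub a h) (fun k => by
      rw [Fin.partialSum_succ, add_sub_cancel_left, MonoidAlgebra.lift_of]
      simp [laurentTwist, d, a, fanDegree])
  have h := lift_laurentTwist_injective d
  rw [← hg] at h
  exact Function.Injective.of_comp h

/-- The sum of the normalized edges between `1` and `j + 1`, in the group algebra. -/
noncomputable def fanPoint (j : Fin (m + 1)) : MonoidAlgebra ℚ (FreeGroup (FanIndex m)) :=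
  Fin.partialSum (fun k => MonoidAlgebra.of ℚ _ (FreeGroup.of (Sum.inr (Sum.inr k)))) j

theorem isUnit_fanHom_fanPoint_sub {i j : Fin (m + 1)} (h : i < j) :
    IsUnit (fanHom m (fanPoint j - fanPoint i)) := by
  have := map_partialSum_sub (fanHom m).toRingHom
    (fun k => fanHom_of (Sum.inr (Sum.inr k))) h
  exact ⟨_, this.symm⟩

/-- The elements of the subalgebra of the fan that are invertible in the polygon algebra. -/
noncomputable def fanSubmonoid (m : ℕ) : Submonoid (fanHom m).range :=
  (IsUnit.submonoid (PolygonAlgebra (m + 2))).comap (fanHom m).range.val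

/-- The submonoid contains the differences of the `fanPoint`s, so the polygon algebra maps to the
localization; its elements are units in the polygon algebra, which gives the map back. -/
theorem isUnivLoc_fanSubmonoid (m : ℕ) :
    IsUnivLoc (R := (fanHom m).range) (R' := PolygonAlgebra (m + 2)) (fanSubmonoid m)
      (fanHom m).range.val.toRingHom := by
  let c := UnivLoc.can (R := (fanHom m).range) (fanSubmonoid m)
  let : Algebra ℚ (UnivLoc (R := (fanHom m).range) (fanSubmonoid m)) :=
    (c.comp (algebraMap ℚ _)).toAlgebra' (fun q x => commute_map_rat _ q x)
  let cAlg : (fanHom m).range →ₐ[ℚ] UnivLoc (R := (fanHom m).range) (fanSubmonoid m) :=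
    ⟨c, fun _ => rfl⟩
  obtain ⟨g, hg⟩ := exists_comp_fanHom_eq (cAlg.comp (fanHom m).rangeRestrict)
    (fun j => cAlg.comp (fanHom m).rangeRestrict (fanPoint j))
    (fun i j h => by
      rw [← map_sub]
      exact UnivLoc.isUnit_can (R := (fanHom m).range) (fanSubmonoid m)
        ⟨(fanHom m).rangeRestrict (fanPoint j - fanPoint i), isUnit_fanHom_fanPoint_sub h⟩)
    (fun k => by
      rw [← map_sub, fanPoint, fanPoint, Fin.partialSum_succ, add_sub_cancel_left])
  have hgc : ∀ a : (fanHom m).range, g a = c a := by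
    rintro ⟨_, a, rfl⟩
    exact DFunLike.congr_fun hg a
  obtain ⟨h, hh, -⟩ := UnivLoc.existsUnique_lift (R := (fanHom m).range) (fanSubmonoid m)
    (fanHom m).range.val.toRingHom (fun s => s.2)
  have hhc : ∀ a, h (c a) = (a : PolygonAlgebra (m + 2)) := DFunLike.congr_fun hh
  -- Both composites are identities by uniqueness: here in the universal property of the
  -- localization, and for `hhg` on the fan generators.
  have hgh : (g : _ →+* _).comp h = RingHom.id _ := by
    refine (UnivLoc.existsUnique_lift (R := (fanHom m).range) (fanSubmonoid m) c
      (UnivLoc.isUnit_can (R := (fanHom m).range) _)).unique ?_ (RingHom.id_comp _)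
    ext a
    exact (congrArg g (hhc a)).trans (hgc a)
  have hfan : ∀ a, h (g (fanGen a).val) = fanGen a := by
    intro a
    have := hgc ((fanHom m).rangeRestrict (MonoidAlgebra.of ℚ _ (FreeGroup.of a)))
    rw [← fanHom_of]
    exact (congrArg h this).trans (hhc _)
  have hhg : (h.comp (g : _ →+* _)).toRatAlgHom = AlgHom.id ℚ _ :=
    algHom_ext_fan (fun j => hfan (Sum.inl j)) (fun j => hfan (Sum.inr (Sum.inl j)))
      (fun k => hfan (Sum.inr (Sum.inr k)))
  exact ⟨RingEquiv.ofRingHom h (g : _ →+* _)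
    (RingHom.ext fun a => DFunLike.congr_fun hhg a) hgh, hhc⟩

end PolygonAlgebra

theorem theorem2p1 (n : ℕ) (hn : 2 ≤ n) :
    ∃ A' : Subalgebra ℚ (PolygonAlgebra n),
      Nonempty (A' ≃ₐ[ℚ] MonoidAlgebra ℚ (FreeGroup (Fin (3 * n - 4)))) ∧
      ∃ S : Submonoid A', (0 : A') ∉ S ∧
        IsUnivLoc (R := A') (R' := PolygonAlgebra n) S A'.val.toRingHom := by
  obtain ⟨m, rfl⟩ := Nat.exists_eq_add_of_le' hn
  have e : PolygonAlgebra.FanIndex m ≃ Fin (3 * (m + 2) - 4) :=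
    Fintype.equivFinOfCardEq (by simp only [Fintype.card_sum, Fintype.card_fin]; omega)
  refine ⟨(PolygonAlgebra.fanHom m).range,
    ⟨(AlgEquiv.ofInjective _ (PolygonAlgebra.fanHom_injective m)).symm.trans
      (MonoidAlgebra.domCongr ℚ ℚ (FreeGroup.freeGroupCongr e))⟩,
    PolygonAlgebra.fanSubmonoid m, fun h => ?_, PolygonAlgebra.isUnivLoc_fanSubmonoid m⟩
  -- A zero in the submonoid would be a unit of the polygon algebra, which is nonzero since it
  -- contains the group algebra.
  have : Nontrivial (PolygonAlgebra (m + 2)) := (PolygonAlgebra.fanHom_injective m).nontrivial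
  exact not_isUnit_zero (M₀ := PolygonAlgebra (m + 2)) h
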